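/- Let $M$ be a smooth $m$-dimensional manifold (Hausdorff, second countable, without boundary), and let $\mathbf{T}M=TM\oplus T^*M$, with the neutral metric $g((X,\alpha),(Y,\mu))=\alpha(Y)+\mu(X)$ and the Courant bracket $$[(X,\alpha),(Y,\mu)]=\bigl([X,Y],\,L_X\mu-L_Y\alpha+\tfrac12 d(\alpha(Y)-\mu(X))\bigr)$$ on the space $\Gamma\mathbf{T}M$ of smooth sections. Let $\tau$ be a generalized 2-nilpotent structure, i.e. a smooth bundle endomorphism of $\mathbf{T}M$ of constant rank with $\tau^2=0$ and $g(\mathcal X,\tau\mathcal Y)+g(\tau\mathcal X,\mathcal Y)=0$. Let $E=\operatorname{im}\tau$, and let $\omega$ be the 2-form on $E$ defined by $\omega(e_1,e_2)=g(e_1,\mathcal X_2)$ for any $\mathcal X_2$ with $\tau\mathcal X_2=e_2$ (the value does not depend on the choice of $\mathcal X_2$). The Courant–Nijenhuis torsion of $\tau$ is $$\mathcal N_\tau(\mathcal X,\mathcal Y)=[\tau\mathcal X,\tau\mathcal Y]-\tau[\mathcal X,\tau\mathcal Y]-\tau[\tau\mathcal X,\mathcal Y]+\tau^2[\mathcal X,\mathcal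 Y].$$ If $\Gamma E$ is closed under the Courant bracket, then $E$ is regarded as a Lie algebroid (a standard fact) with this bracket and the anchor $\rho=pr_{TM}|_E$, and the exterior differential of a 2-form $\eta$ on $E$ is, for $a,b,c\in\Gamma E$, $$d_E\eta(a,b,c)=\rho(a)(\eta(b,c))-\rho(b)(\eta(a,c))+\rho(c)(\eta(a,b))-\eta([a,b],c)+\eta([a,c],b)-\eta([b,c],a).$$ A symplectic form of $E$ is a smooth, nondegenerate 2-form $\eta$ on $E$ (a section of $\wedge^2E^*$) with $d_E\eta=0$. Then $\mathcal N_\tau=0$ if and only if $\Gamma E$ is closed under the Courant bracket and $\omega$ is a symplectic form of the Lie algebroid $E$. Moreover, whenever $\Gamma E$ is closed under the Courant bracket, one has, for all $\mathcal X,\mathcal Y,\mathcal Z\in\Gamma\mathbf{T}M$, $$d_E\omega(\tau\mathcal X,\tau\mathcal Y,\tau\mathcal Z)=-g(\mathcal X,\mathcal N_\tau(\mathcal Y,\mathcal Z)).$$ -/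

import Mathlib

open Bundle VectorField
open scoped Manifold ContDiff Topology

noncomputable section

namespace BigTangent

/-! ### The big tangent bundle `TM ⊕ T*M` of an `m`-dimensional smooth manifold, and sections -/

section Bundles

/-- The model space `ℝᵐ`. -/
abbrev Mod (m : ℕ) : Type := EuclideanSpace ℝ (Fin m)

/-- The model fibre `ℝᵐ ⊕ (ℝᵐ)*` of the big tangent bundle. -/
abbrev BigMod (m : ℕ) : Type := Mod m × (Mod m →L[ℝ] ℝ)

variable (m : ℕ) (M : Type*) [TopologicalSpace M] [ChartedSpace (EuclideanSpace ℝ (Fin m)) M]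

/-- The tangent space `T_xM`. -/
abbrev Tan (x : M) : Type := TangentSpace (𝓡 m) x

/-- The cotangent space `T_x*M`. -/
abbrev Cot (x : M) : Type := Tan m M x →L[ℝ] ℝ

/-- The fibre `T_xM ⊕ T_x*M` of the big tangent bundle. -/
abbrev Big (x : M) : Type := Tan m M x × Cot m M x

variable [IsManifold (𝓡 m) ∞ M]

/-- Smooth functions on `M`. -/
abbrev SmoothFun := C^∞⟮𝓡 m, M; 𝓘(ℝ, ℝ), ℝ⟯

/-- Smooth vector fields on `M`. -/
abbrev VecField := Cₛ^∞⟮𝓡 m; Mod m, Tan m M⟯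

/-- Smooth differential 1-forms on `M`. -/
abbrev OneForm := Cₛ^∞⟮𝓡 m; Mod m →L[ℝ] ℝ, Cot m M⟯

/-- Smooth sections of the big tangent bundle. -/
abbrev BigSection := Cₛ^∞⟮𝓡 m; BigMod m, Big m M⟯

/-- Smooth vector bundle endomorphisms of the big tangent bundle. -/
abbrev BigEndo := Cₛ^∞⟮𝓡 m; BigMod m →L[ℝ] BigMod m, fun x : M => Big m M x →L[ℝ] Big m M x⟯

end Bundles

variable {m : ℕ} {M : Type*} [TopologicalSpace M] [ChartedSpace (EuclideanSpace ℝ (Fin m)) M]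
  [IsManifold (𝓡 m) ∞ M]

/-! ### Smoothness facts needed to build the operations on sections -/

section Smoothness

theorem contMDiffAt_pair {X : ∀ x : M, Tan m M x} {μ : ∀ x : M, Cot m M x} {x : M}
    (hμ : ContMDiffAt (𝓡 m) ((𝓡 m).prod 𝓘(ℝ, Mod m →L[ℝ] ℝ)) ∞
      (fun y => TotalSpace.mk' (Mod m →L[ℝ] ℝ) (E := Cot m M) y (μ y)) x)
    (hX : ContMDiffAt (𝓡 m) ((𝓡 m).prod 𝓘(ℝ, Mod m)) ∞
      (fun y => TotalSpace.mk' (Mod m) (E := Tan m M) y (X y)) x) :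
    ContMDiffAt (𝓡 m) 𝓘(ℝ, ℝ) ∞ (fun y => μ y (X y)) x :=
  (contMDiffAt_section x).1
    (ContMDiffAt.clm_bundle_apply (F₂ := ℝ) (E₂ := Bundle.Trivial M ℝ) hμ hX)

theorem mdifferentiableAt_pair {X : ∀ x : M, Tan m M x} {μ : ∀ x : M, Cot m M x} {x : M}
    (hμ : MDifferentiableAt (𝓡 m) ((𝓡 m).prod 𝓘(ℝ, Mod m →L[ℝ] ℝ))
      (fun y => TotalSpace.mk' (Mod m →L[ℝ] ℝ) (E := Cot m M) y (μ y)) x)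
    (hX : MDifferentiableAt (𝓡 m) ((𝓡 m).prod 𝓘(ℝ, Mod m))
      (fun y => TotalSpace.mk' (Mod m) (E := Tan m M) y (X y)) x) :
    MDifferentiableAt (𝓡 m) 𝓘(ℝ, ℝ) (fun y => μ y (X y)) x :=
  ((mdifferentiableAt_totalSpace _ _).1
    (MDifferentiableAt.clm_bundle_apply (F₂ := ℝ) (E₂ := Bundle.Trivial M ℝ) hμ hX)).2

theorem contMDiffAt_mvfderiv {f : M → ℝ} {X : ∀ x : M, Tan m M x} {x : M}
    (hf : ContMDiffAt (𝓡 m) 𝓘(ℝ, ℝ) ∞ f x)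
    (hX : ContMDiffAt (𝓡 m) ((𝓡 m).prod 𝓘(ℝ, Mod m)) ∞
      (fun y => TotalSpace.mk' (Mod m) (E := Tan m M) y (X y)) x) :
    ContMDiffAt (𝓡 m) 𝓘(ℝ, ℝ) ∞ (fun y => mvfderiv (𝓡 m) f y (X y)) x := by
  have h1 := hf.mfderiv_const (m := ∞) (by simp)
  have h2 := ContMDiffAt.clm_apply_of_inCoordinates (b₁ := id) (b₂ := f) h1 hX hf
  rw [contMDiffAt_totalSpace] at h2
  refine h2.2.congr_of_eventuallyEq (.of_forall fun y => ?_)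
  simp [mvfderiv]
  rfl

theorem contMDiffAt_mlieBracket {X Y : ∀ x : M, Tan m M x} {x : M}
    (hX : ContMDiffAt (𝓡 m) ((𝓡 m).prod 𝓘(ℝ, Mod m)) ∞
      (fun y => TotalSpace.mk' (Mod m) (E := Tan m M) y (X y)) x)
    (hY : ContMDiffAt (𝓡 m) ((𝓡 m).prod 𝓘(ℝ, Mod m)) ∞
      (fun y => TotalSpace.mk' (Mod m) (E := Tan m M) y (Y y)) x) :
    ContMDiffAt (𝓡 m) ((𝓡 m).prod 𝓘(ℝ, Mod m)) ∞
      (fun y => TotalSpace.mk' (Mod m) (E := Tan m M) y (mlieBracket (𝓡 m) X Y y)) x := by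
  have : IsManifold (𝓡 m) (minSmoothness ℝ 2) M := by
    rw [minSmoothness_of_isRCLikeNormedField]
    infer_instance
  have : IsManifold (𝓡 m) (((⊤ : ℕ∞) : WithTop ℕ∞) + 1) M := ‹IsManifold (𝓡 m) ∞ M›
  exact ContMDiffAt.mlieBracket_vectorField (n := ⊤) (m := ⊤) hX hY
    (by rw [minSmoothness_of_isRCLikeNormedField]; rfl)

/-- A field of covectors is smooth at `x` if its pairings with the vector fields that are smooth
near `x` are. -/
theorem contMDiffAt_oneForm {φ : ∀ x : M, Cot m M x} {x : M}
    (h : ∀ X : ∀ y : M, Tan m M y,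
      (∀ᶠ z in 𝓝 x, ContMDiffAt (𝓡 m) ((𝓡 m).prod 𝓘(ℝ, Mod m)) ∞
        (fun y => TotalSpace.mk' (Mod m) (E := Tan m M) y (X y)) z) →
      ContMDiffAt (𝓡 m) 𝓘(ℝ, ℝ) ∞ (fun y => φ y (X y)) x) :
    ContMDiffAt (𝓡 m) ((𝓡 m).prod 𝓘(ℝ, Mod m →L[ℝ] ℝ)) ∞
      (fun y => TotalSpace.mk' (Mod m →L[ℝ] ℝ) (E := Cot m M) y (φ y)) x := by
  rw [contMDiffAt_hom_bundle (E₂ := Bundle.Trivial M ℝ)]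
  refine ⟨contMDiffAt_id, ?_⟩
  let e := trivializationAt (Mod m) (Tan m M) x
  let b := (EuclideanSpace.basisFun (Fin m) ℝ).toBasis
  have hx : x ∈ e.baseSet := FiberBundle.mem_baseSet_trivializationAt (Mod m) (Tan m M) x
  have hb : ∀ᶠ y in 𝓝 x, y ∈ e.baseSet := e.open_baseSet.mem_nhds hx
  have key : ContMDiffAt (𝓡 m) 𝓘(ℝ, Mod m →L[ℝ] ℝ) ∞
      (fun y => ∑ i, (φ y (e.localFrame b i y)) • (EuclideanSpace.proj i : Mod m →L[ℝ] ℝ)) x := by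
    refine ContMDiffAt.sum fun i _ => ?_
    refine ContMDiffAt.smul (h _ ?_) contMDiffAt_const
    exact hb.mono fun z hz => contMDiffAt_localFrame_of_mem ∞ e b i hz
  refine key.congr_of_eventuallyEq (hb.mono fun y hy => ?_)
  apply ContinuousLinearMap.coe_injective
  refine b.ext fun j => ?_
  have hj : e.localFrame b j y = e.symmL ℝ y (b j) := by
    rw [Trivialization.localFrame_apply_of_mem_baseSet e b hy]
    simp [Trivialization.basisAt]
    exact (e.symmL_apply (R := ℝ) hy (b j)).symm
  have h1 : (∑ i, (φ y (e.localFrame b i y)) • (EuclideanSpace.proj i : Mod m →L[ℝ] ℝ)) (b j)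
      = φ y (e.localFrame b j y) := by
    simp only [sum_apply, smul_apply, smul_eq_mul]
    rw [Finset.sum_eq_single j (fun i _ hij => by simp [b, hij]) (by simp)]
    simp [b]
  refine Eq.trans ?_ h1.symm
  rw [hj]
  simp [e, ContinuousLinearMap.inCoordinates]

/-- The expression `X(μ(Z)) - μ([X, Z])` is function-linear in the vector field `Z`. -/
theorem tensorialAt_lieDeriv (X : ∀ x : M, Tan m M x) (μ : OneForm m M) (x : M) :
    TensorialAt (𝓡 m) (Mod m)
      (fun Z : ∀ x : M, Tan m M x =>
        mvfderiv (𝓡 m) (fun y => μ y (Z y)) x (X x) - μ x (mlieBracket (𝓡 m) X Z x)) x where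
  smul {f Z} hf hZ := by
    have := mvfderiv_fun_mul hf (mdifferentiableAt_pair μ.mdifferentiableAt hZ)
    simp [mlieBracket_smul_right hf hZ, this]
    ring
  add {Z Z'} hZ hZ' := by
    have := mvfderiv_fun_add (mdifferentiableAt_pair μ.mdifferentiableAt hZ)
      (mdifferentiableAt_pair μ.mdifferentiableAt hZ')
    simp [mlieBracket_add_right hZ hZ', this]
    ring

end Smoothness

/-! ### Operations on functions, vector fields and 1-forms -/

section Cartan

/-- The function `μ(X)`. -/
def pair (μ : OneForm m M) (X : VecField m M) : SmoothFun m M :=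
  ⟨fun x => μ x (X x), fun x => contMDiffAt_pair (μ.contMDiff x) (X.contMDiff x)⟩

/-- The differential `df` of a function. -/
def differential (f : SmoothFun m M) : OneForm m M :=
  ⟨fun x => mvfderiv (𝓡 m) f x, fun x => contMDiffAt_oneForm fun _ hX =>
    contMDiffAt_mvfderiv (f.contMDiff x) hX.self_of_nhds⟩

/-- The Lie bracket of vector fields. -/
def bracket (X Y : VecField m M) : VecField m M :=
  ⟨fun x => mlieBracket (𝓡 m) X Y x, fun x =>
    contMDiffAt_mlieBracket (X.contMDiff x) (Y.contMDiff x)⟩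

/-- The value at `x` of the Lie derivative `L_X μ`: the covector which maps `Z x` to
`X(μ(Z)) - μ([X, Z])` at `x`, for every vector field `Z` that is differentiable at `x`. -/
def lieDerivAt (X : VecField m M) (μ : OneForm m M) (x : M) : Cot m M x :=
  TensorialAt.mkHom (I := 𝓡 m) (F := Mod m) (V := Tan m M)
    (fun Z : ∀ x : M, Tan m M x =>
      mvfderiv (𝓡 m) (fun y => μ y (Z y)) x (X x) - μ x (mlieBracket (𝓡 m) X Z x)) x
    (tensorialAt_lieDeriv X μ x)

theorem lieDerivAt_apply (X : VecField m M) (μ : OneForm m M) {x : M} {Z : ∀ x : M, Tan m M x}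
    (hZ : MDifferentiableAt (𝓡 m) ((𝓡 m).prod 𝓘(ℝ, Mod m))
      (fun y => TotalSpace.mk' (Mod m) (E := Tan m M) y (Z y)) x) :
    lieDerivAt X μ x (Z x) =
      mvfderiv (𝓡 m) (fun y => μ y (Z y)) x (X x) - μ x (mlieBracket (𝓡 m) X Z x) :=
  TensorialAt.mkHom_apply (tensorialAt_lieDeriv X μ x) hZ

/-- The Lie derivative `L_X μ` of a 1-form. -/
def lieDeriv (X : VecField m M) (μ : OneForm m M) : OneForm m M :=
  ⟨fun x => lieDerivAt X μ x, fun x => contMDiffAt_oneForm fun Z hZ => by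
    have h1 : ContMDiffAt (𝓡 m) 𝓘(ℝ, ℝ) ∞ (fun y =>
        mvfderiv (𝓡 m) (fun y => μ y (Z y)) y (X y) - μ y (mlieBracket (𝓡 m) X Z y)) x :=
      (contMDiffAt_mvfderiv (contMDiffAt_pair (μ.contMDiff x) hZ.self_of_nhds)
        (X.contMDiff x)).sub
      (contMDiffAt_pair (μ.contMDiff x)
        (contMDiffAt_mlieBracket (X.contMDiff x) hZ.self_of_nhds))
    exact h1.congr_of_eventuallyEq
      (hZ.mono fun y hy => lieDerivAt_apply X μ (hy.mdifferentiableAt (by simp)))⟩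

end Cartan

/-! ### The neutral metric and the Courant bracket -/

section Courant

/-- The section `(X, α)` of the big tangent bundle. -/
def mkSection (X : VecField m M) (α : OneForm m M) : BigSection m M :=
  ⟨fun x => (X x, α x), fun x => (contMDiffAt_section x).2
    (((contMDiffAt_section x).1 (X.contMDiff x)).prodMk_space
      ((contMDiffAt_section x).1 (α.contMDiff x)))⟩

/-- The projection of a section `(X, α)` to the vector field `X`. -/
def prTan (s : BigSection m M) : VecField m M :=
  ⟨fun x => (s x).1, fun x => (contMDiffAt_section x).2
    (contDiff_fst.contMDiff.contMDiffAt.comp x ((contMDiffAt_section x).1 (s.contMDiff x)))⟩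

/-- The projection of a section `(X, α)` to the 1-form `α`. -/
def prCot (s : BigSection m M) : OneForm m M :=
  ⟨fun x => (s x).2, fun x => (contMDiffAt_section x).2
    ((contDiff_snd (E := Mod m)).contMDiff.contMDiffAt.comp x ((contMDiffAt_section x).1 (s.contMDiff x)))⟩

/-- The neutral metric `g((X, α), (Y, μ)) = α(Y) + μ(X)`, at a point. -/
def neutral {x : M} (u v : Big m M x) : ℝ := u.2 v.1 + v.2 u.1

/-- The Courant bracket
`[(X, α), (Y, μ)] = ([X, Y], L_X μ - L_Y α + (1/2) d(α(Y) - μ(X)))`. -/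
def courant (s t : BigSection m M) : BigSection m M :=
  mkSection (bracket (prTan s) (prTan t))
    (lieDeriv (prTan s) (prCot t) - lieDeriv (prTan t) (prCot s)
      + (1 / 2 : ℝ) • differential (pair (prCot s) (prTan t) - pair (prCot t) (prTan s)))

/-- The section `τ s`. -/
def apply (τ : BigEndo m M) (s : BigSection m M) : BigSection m M :=
  ⟨fun x => τ x (s x), τ.contMDiff.clm_bundle_apply s.contMDiff⟩

/-- The Courant-Nijenhuis torsion
`N_τ(s, t) = [τ s, τ t] - τ [s, τ t] - τ [τ s, t] + τ² [s, t]`. -/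
def torsion (τ : BigEndo m M) (s t : BigSection m M) : BigSection m M :=
  courant (apply τ s) (apply τ t) - apply τ (courant s (apply τ t))
    - apply τ (courant (apply τ s) t) + apply τ (apply τ (courant s t))

end Courant

/-! ### Generalized 2-nilpotent structures -/

section TwoNilpotent

/-- The fibre at `x` of the image `E = im τ`. -/
def image (τ : BigEndo m M) (x : M) : Submodule ℝ (Big m M x) :=
  LinearMap.range (τ x : Big m M x →ₗ[ℝ] Big m M x)

/-- Generalized 2-nilpotent structures: `τ² = 0`, `τ` is skew for the neutral metric, and `τ` has
constant rank. -/
structure IsTwoNilpotent (τ : BigEndo m M) : Prop where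
  sq_zero : ∀ (x : M) (u : Big m M x), τ x (τ x u) = 0
  skew : ∀ (x : M) (u v : Big m M x), neutral u (τ x v) + neutral (τ x u) v = 0
  const_rank : ∃ r : ℕ, ∀ x : M, Module.finrank ℝ (image τ x) = r

/-- Integrability of `τ`: the Courant-Nijenhuis torsion vanishes. -/
def IsIntegrable (τ : BigEndo m M) : Prop := ∀ s t : BigSection m M, torsion τ s t = 0

/-- The space `Γ E` of smooth sections of `E = im τ`. -/
def imageSections (τ : BigEndo m M) : Submodule ℝ (BigSection m M) where
  carrier := {s | ∀ x, s x ∈ image τ x}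
  add_mem' hs ht x := (image τ x).add_mem (hs x) (ht x)
  zero_mem' x := (image τ x).zero_mem
  smul_mem' c _ hs x := (image τ x).smul_mem c (hs x)

/-- The section `τ s` of `E = im τ`. -/
def applyImage (τ : BigEndo m M) (s : BigSection m M) : imageSections τ :=
  ⟨apply τ s, fun x => ⟨s x, rfl⟩⟩

/-- The value at `x` of a section of `E = im τ`. -/
def valueAt {τ : BigEndo m M} (a : imageSections τ) (x : M) : image τ x := ⟨a.1 x, a.2 x⟩

/-- Weak integrability of `τ`: `Γ E` is closed under the Courant bracket. -/
def IsWeaklyIntegrable (τ : BigEndo m M) : Prop :=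
  ∀ a ∈ imageSections τ, ∀ b ∈ imageSections τ, courant a b ∈ imageSections τ

/-- If `τ u = τ u'`, then `g(e, u) = g(e, u')` for all `e` in the image of `τ`. -/
theorem neutral_eq_of_apply_eq {τ : BigEndo m M} (hτ : IsTwoNilpotent τ) {x : M}
    {e : Big m M x} (he : e ∈ image τ x) {u u' : Big m M x} (h : τ x u = τ x u') :
    neutral e u = neutral e u' := by
  obtain ⟨w, rfl⟩ := he
  have h1 := hτ.skew x w u
  have h2 := hτ.skew x w u'
  rw [h] at h1
  exact add_left_cancel (h1.trans h2.symm)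

/-- The 2-form `ω` on `E = im τ`, given by `ω(e₁, e₂) = g(e₁, u₂)` for any `u₂` with
`τ u₂ = e₂`. -/
def omega {τ : BigEndo m M} (hτ : IsTwoNilpotent τ) (x : M) :
    LinearMap.BilinForm ℝ (image τ x) :=
  LinearMap.mk₂ ℝ (fun e₁ e₂ => neutral e₁.1 e₂.2.choose)
    (fun e e' f => by simp [neutral]; ring)
    (fun c e f => by simp [neutral]; ring)
    (fun e f f' => by
      have h : τ x (f + f').2.choose = τ x (f.2.choose + f'.2.choose) := by
        rw [(τ x).map_add]
        exact (f + f').2.choose_spec.trans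
          (congrArg₂ (· + ·) f.2.choose_spec f'.2.choose_spec).symm
      rw [neutral_eq_of_apply_eq hτ e.2 h]
      simp [neutral]; ring)
    (fun c e f => by
      have h : τ x (c • f).2.choose = τ x (c • f.2.choose) := by
        rw [(τ x).map_smul]
        exact (c • f).2.choose_spec.trans (congrArg (c • ·) f.2.choose_spec).symm
      rw [neutral_eq_of_apply_eq hτ e.2 h]
      simp [neutral]; ring)

/-- The form `ω` does not depend on the choice of the preimage. -/
theorem omega_apply {τ : BigEndo m M} (hτ : IsTwoNilpotent τ) {x : M} (e₁ e₂ : image τ x)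
    {u : Big m M x} (hu : τ x u = e₂.1) : omega hτ x e₁ e₂ = neutral e₁.1 u :=
  neutral_eq_of_apply_eq hτ e₁.2 (e₂.2.choose_spec.trans hu.symm)

end TwoNilpotent

/-! ### The Lie algebroid `E` of a weakly integrable structure -/

section Algebroid

variable {τ : BigEndo m M}

/-- The bracket of the Lie algebroid `E`: the restriction of the Courant bracket to `Γ E`. -/
def algBracket (h : IsWeaklyIntegrable τ) (a b : imageSections τ) : imageSections τ :=
  ⟨courant a b, h a a.2 b b.2⟩

/-- The anchor of the Lie algebroid `E`: the restriction of the projection to `TM`. -/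
def anchor (a : imageSections τ) : VecField m M := prTan a.1

/-- The evaluation `η(a, b)` of a field of bilinear forms on `E` on two sections of `E`. -/
def evalForm (η : ∀ x : M, LinearMap.BilinForm ℝ (image τ x)) (a b : imageSections τ) : M → ℝ :=
  fun x => η x (valueAt a x) (valueAt b x)

/-- The exterior differential `d_E η` of a 2-form `η` of the Lie algebroid `E`,
`d_E η(a, b, c) = ρ(a)(η(b, c)) - ρ(b)(η(a, c)) + ρ(c)(η(a, b))
  - η([a, b], c) + η([a, c], b) - η([b, c], a)`, where `ρ` is the anchor. -/
def algDiff (h : IsWeaklyIntegrable τ) (η : ∀ x : M, LinearMap.BilinForm ℝ (image τ x))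
    (a b c : imageSections τ) (x : M) : ℝ :=
  mvfderiv (𝓡 m) (evalForm η b c) x (anchor a x)
    - mvfderiv (𝓡 m) (evalForm η a c) x (anchor b x)
    + mvfderiv (𝓡 m) (evalForm η a b) x (anchor c x)
    - evalForm η (algBracket h a b) c x
    + evalForm η (algBracket h a c) b x
    - evalForm η (algBracket h b c) a x

/-- Symplectic forms of the Lie algebroid `E`: smooth, alternating, nondegenerate 2-forms `η` on
`E` with `d_E η = 0`. -/
structure IsSymplecticForm (h : IsWeaklyIntegrable τ)
    (η : ∀ x : M, LinearMap.BilinForm ℝ (image τ x)) : Prop where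
  smooth : ∀ a b : imageSections τ, ContMDiff (𝓡 m) 𝓘(ℝ, ℝ) ∞ (evalForm η a b)
  alt : ∀ x : M, (η x).IsAlt
  nondegenerate : ∀ x : M, (η x).Nondegenerate
  closed : ∀ (a b c : imageSections τ) (x : M), algDiff h η a b c x = 0

end Algebroid

end BigTangent

end

/-! Write a = τX, b = τY, c = τZ. Since ω(e, τu) = g(e, u), the derivative terms of d_E ω are
derivatives of functions g(a, Z), g(a, Y), g(b, Z). The compatibility of the Courant bracket with g
(`mvfderiv_neutral_eq_courant`) turns those along b and c into brackets, up to correction terms that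
isotropy of E and skewness of τ reduce to derivatives along a. All derivatives then cancel, and what
remains is -g(X, N_τ(Y, Z)) once τ is moved across g. This is `algDiff_omega`.

The equivalence then needs two supplies of sections. Every section of E is globally τs
(`applyImage_surjective`): constant rank gives local lifts, and a partition of unity glues them, the
lifts forming an affine space in each fibre. So vanishing torsion closes ΓE under the bracket and
gives d_E ω = 0 on all of ΓE. Conversely, every vector is the value of a section
(`exists_section_apply_eq`), so d_E ω = 0 and nondegeneracy of g force N_τ = 0. That ω is
alternating and nondegenerate is pointwise algebra. -/

namespace BigTangent

variable {m : ℕ} {M : Type*} [TopologicalSpace M] [ChartedSpace (EuclideanSpace ℝ (Fin m)) M]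

/-! ### Algebra of the neutral metric -/

section Neutral

theorem neutral_comm {x : M} (u v : Big m M x) : neutral u v = neutral v u := add_comm _ _

theorem neutral_sub_left {x : M} (u u' v : Big m M x) :
    neutral (u - u') v = neutral u v - neutral u' v := by
  simp [neutral]; ring

theorem neutral_neg_left {x : M} (u v : Big m M x) : neutral (-u) v = -neutral u v := by
  simp [neutral]; ring

/-- The neutral metric is nondegenerate. -/
theorem eq_zero_of_forall_neutral {x : M} {u : Big m M x} (h : ∀ v, neutral u v = 0) : u = 0 := by
  have h2 : u.2 = 0 := by
    ext z
    simpa [neutral] using h (z, 0)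
  have h1 : u.1 = 0 := by
    refine SeparatingDual.eq_zero_of_forall_dual_eq_zero (R := ℝ) (V := Mod m) fun f => ?_
    have hf := h (0, f)
    simp only [neutral, map_zero, zero_add] at hf
    exact hf
  exact Prod.ext h1 h2

end Neutral

variable [IsManifold (𝓡 m) ∞ M]

/-! ### The Courant bracket and the neutral metric -/

section Metric

theorem mdifferentiableAt_pairing (s t : BigSection m M) (x : M) :
    MDifferentiableAt (𝓡 m) 𝓘(ℝ, ℝ) (fun y => (s y).2 (t y).1) x :=
  mdifferentiableAt_pair (prCot s).mdifferentiableAt (prTan t).mdifferentiableAt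

theorem contMDiff_neutral (s t : BigSection m M) :
    ContMDiff (𝓡 m) 𝓘(ℝ, ℝ) ∞ (fun x => neutral (s x) (t x)) :=
  (pair (prCot s) (prTan t)).contMDiff.add (pair (prCot t) (prTan s)).contMDiff

theorem mvfderiv_neutral (s t : BigSection m M) (x : M) (v : Tan m M x) :
    mvfderiv (𝓡 m) (fun y => neutral (s y) (t y)) x v
      = mvfderiv (𝓡 m) (fun y => (s y).2 (t y).1) x v
        + mvfderiv (𝓡 m) (fun y => (t y).2 (s y).1) x v := by
  have := mvfderiv_fun_add (mdifferentiableAt_pairing s t x) (mdifferentiableAt_pairing t s x)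
  exact DFunLike.congr_fun this v

/-- Pairing with the section t allows both Lie derivatives to be evaluated on the vector field of t.
-/
theorem neutral_courant (e s t : BigSection m M) (x : M) :
    neutral (courant e s x) (t x)
      = (mvfderiv (𝓡 m) (fun y => (s y).2 (t y).1) x (e x).1
          - (s x).2 (mlieBracket (𝓡 m) (prTan e) (prTan t) x))
        - (mvfderiv (𝓡 m) (fun y => (e y).2 (t y).1) x (s x).1
          - (e x).2 (mlieBracket (𝓡 m) (prTan s) (prTan t) x))
        + 1 / 2 * (mvfderiv (𝓡 m) (fun y => (e y).2 (s y).1) x (t x).1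
          - mvfderiv (𝓡 m) (fun y => (s y).2 (e y).1) x (t x).1)
        + (t x).2 (mlieBracket (𝓡 m) (prTan e) (prTan s) x) := by
  have h1 := lieDerivAt_apply (prTan e) (prCot s) (x := x) (prTan t).mdifferentiableAt
  have h2 := lieDerivAt_apply (prTan s) (prCot e) (x := x) (prTan t).mdifferentiableAt
  have h3 := DFunLike.congr_fun (mvfderiv_fun_sub (mdifferentiableAt_pairing e s x)
    (mdifferentiableAt_pairing s e x)) (t x).1
  refine congrArg₂ (· + ·) (congrArg₂ (· + ·) (congrArg₂ (· - ·) h1 h2) ?_) rfl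
  exact congrArg ((1 / 2 : ℝ) * ·) h3

/-- Compatibility of the Courant bracket with the neutral metric: with `∂f = (0, df)`,
`ρ(e)(g(s, t)) = g([e, s] + ½ ∂g(e, s), t) + g(s, [e, t] + ½ ∂g(e, t))`. -/
theorem mvfderiv_neutral_eq_courant (e s t : BigSection m M) (x : M) :
    mvfderiv (𝓡 m) (fun y => neutral (s y) (t y)) x (prTan e x)
      = neutral (courant e s x) (t x) + neutral (courant e t x) (s x)
        + 1 / 2 * mvfderiv (𝓡 m) (fun y => neutral (e y) (s y)) x (prTan t x)
        + 1 / 2 * mvfderiv (𝓡 m) (fun y => neutral (e y) (t y)) x (prTan s x) := by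
  -- In the sum of the two pairings, exchanged under s ↔ t, the other Lie bracket terms cancel as
  -- they stand; this pair needs antisymmetry.
  have hb : (e x).2 (mlieBracket (𝓡 m) (prTan s) (prTan t) x)
      = - (e x).2 (mlieBracket (𝓡 m) (prTan t) (prTan s) x) := by
    rw [mlieBracket_swap_apply, map_neg]
  have p1 : prTan e x = (e x).1 := rfl
  have p2 : prTan s x = (s x).1 := rfl
  have p3 : prTan t x = (t x).1 := rfl
  rw [neutral_courant, neutral_courant, mvfderiv_neutral, mvfderiv_neutral, mvfderiv_neutral, hb,
    p1, p2, p3]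
  ring

theorem courant_swap (s t : BigSection m M) (x : M) : courant t s x = - courant s t x := by
  refine Prod.ext (mlieBracket_swap_apply) ?_
  have h1 := mvfderiv_fun_sub (mdifferentiableAt_pairing s t x) (mdifferentiableAt_pairing t s x)
  have h2 := mvfderiv_fun_sub (mdifferentiableAt_pairing t s x) (mdifferentiableAt_pairing s t x)
  have e1 : (courant s t x).2 = lieDerivAt (prTan s) (prCot t) x - lieDerivAt (prTan t) (prCot s) x
    + (1 / 2 : ℝ) • mvfderiv (𝓡 m) (fun y => (s y).2 (t y).1 - (t y).2 (s y).1) x := rfl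
  have e2 : (courant t s x).2 = lieDerivAt (prTan t) (prCot s) x - lieDerivAt (prTan s) (prCot t) x
    + (1 / 2 : ℝ) • mvfderiv (𝓡 m) (fun y => (t y).2 (s y).1 - (s y).2 (t y).1) x := rfl
  rw [Prod.snd_neg, e1, e2, h1, h2]
  module

end Metric

/-! ### The form ω and its differential -/

section Torsion

variable {τ : BigEndo m M}

theorem neutral_apply_apply (hτ : IsTwoNilpotent τ) {x : M} (u v : Big m M x) :
    neutral (τ x u) (τ x v) = 0 := by
  have h := hτ.skew x u (τ x v)
  rw [hτ.sq_zero] at h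
  simpa [neutral] using h

theorem omega_isAlt (hτ : IsTwoNilpotent τ) (x : M) : (omega hτ x).IsAlt := by
  rintro ⟨_, u, rfl⟩
  rw [omega_apply hτ _ _ (u := u) rfl]
  have h := hτ.skew x u u
  rw [neutral_comm u] at h
  exact self_eq_neg.1 (eq_neg_of_add_eq_zero_left h)

/-- In ω(e, τu) = g(e, u) the vector u is arbitrary, so nondegeneracy of g applies; skewness of τ
treats the other side. -/
theorem omega_nondegenerate (hτ : IsTwoNilpotent τ) (x : M) : (omega hτ x).Nondegenerate := by
  constructor
  · refine fun e he => Subtype.ext (eq_zero_of_forall_neutral fun u => ?_)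
    rw [← omega_apply hτ e ⟨τ x u, u, rfl⟩ rfl]
    exact he _
  · rintro ⟨_, u, rfl⟩ he
    refine Subtype.ext (eq_zero_of_forall_neutral fun w => ?_)
    have h := he ⟨τ x w, w, rfl⟩
    rw [omega_apply hτ _ _ (u := u) rfl] at h
    rw [neutral_comm]
    exact (add_eq_right.1 ((hτ.skew x w u).trans h.symm))

theorem evalForm_omega_applyImage (hτ : IsTwoNilpotent τ) (a : imageSections τ)
    (t : BigSection m M) :
    evalForm (omega hτ) a (applyImage τ t) = fun x => neutral (a.1 x) (t x) :=
  funext fun _ => omega_apply hτ _ _ rfl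

/-- The differential of `ω` is the Courant-Nijenhuis torsion, up to sign. -/
theorem algDiff_omega (hτ : IsTwoNilpotent τ) (h : IsWeaklyIntegrable τ) (X Y Z : BigSection m M)
    (x : M) :
    algDiff h (omega hτ) (applyImage τ X) (applyImage τ Y) (applyImage τ Z) x
      = - neutral (X x) (torsion τ Y Z x) := by
  set a := apply τ X with ha
  set b := apply τ Y with hb
  set c := apply τ Z with hc
  have hba : (fun y => neutral (b y) (a y)) = fun _ => 0 :=
    funext fun y => neutral_apply_apply hτ _ _
  have hca : (fun y => neutral (c y) (a y)) = fun _ => 0 :=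
    funext fun y => neutral_apply_apply hτ _ _
  have hcY : (fun y => neutral (c y) (Y y)) = fun y => - neutral (b y) (Z y) :=
    funext fun y => by
      rw [neutral_comm]
      exact eq_neg_of_add_eq_zero_left (hτ.skew y (Y y) (Z y))
  have hd : mvfderiv (𝓡 m) (fun y => neutral (c y) (Y y)) x (prTan a x)
      = - mvfderiv (𝓡 m) (fun y => neutral (b y) (Z y)) x (prTan a x) := by
    rw [hcY]
    exact DFunLike.congr_fun (mvfderiv_neg (g := fun y => neutral (b y) (Z y))) _
  -- The ½ corrections along Z and Y vanish because E is isotropic. The two along a each contribute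
  -- -½ ρ(a)g(b, Z) to d_E ω, together cancelling its first term.
  have k1 := mvfderiv_neutral_eq_courant b a Z x
  have k2 := mvfderiv_neutral_eq_courant c a Y x
  rw [hba, mvfderiv_const] at k1
  rw [hca, mvfderiv_const, hd] at k2
  -- Skewness moves τ from the brackets onto X, and τ² = 0 removes the last torsion term.
  have hN : neutral (X x) (torsion τ Y Z x) = neutral (courant b c x) (X x)
      + neutral (courant Y c x) (a x) + neutral (courant b Z x) (a x) := by
    have e : torsion τ Y Z x = courant b c x - τ x (courant Y c x) - τ x (courant b Z x)
      + τ x (τ x (courant Y Z x)) := rfl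
    have s1 := hτ.skew x (X x) (courant Y c x)
    have s2 := hτ.skew x (X x) (courant b Z x)
    rw [e, hτ.sq_zero, add_zero, neutral_comm, neutral_sub_left, neutral_sub_left,
      neutral_comm (τ x (courant Y c x)), neutral_comm (τ x (courant b Z x))]
    rw [neutral_comm (courant Y c x), neutral_comm (courant b Z x)]
    change _ = _ + neutral (τ x (X x)) _ + neutral (τ x (X x)) _
    linarith
  have w1 : neutral (courant b a x) (Z x) = - neutral (courant a b x) (Z x) := by
    rw [courant_swap a b, neutral_neg_left]
  have w2 : neutral (courant c a x) (Y x) = - neutral (courant a c x) (Y x) := by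
    rw [courant_swap a c, neutral_neg_left]
  have w3 : neutral (courant c Y x) (a x) = - neutral (courant Y c x) (a x) := by
    rw [courant_swap Y c, neutral_neg_left]
  rw [hN]
  simp only [algDiff, evalForm_omega_applyImage]
  change mvfderiv (𝓡 m) (fun y => neutral (b y) (Z y)) x (prTan a x)
    - mvfderiv (𝓡 m) (fun y => neutral (a y) (Z y)) x (prTan b x)
    + mvfderiv (𝓡 m) (fun y => neutral (a y) (Y y)) x (prTan c x)
    - neutral (courant a b x) (Z x) + neutral (courant a c x) (Y x)
    - neutral (courant b c x) (X x) = _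
  rw [k1, k2, w1, w2, w3, zero_apply, zero_apply]
  ring

end Torsion

end BigTangent

/-! ### Local lifts through a bundle map of constant rank -/

/-- Near a linear map `T₀` between finite-dimensional spaces there is a smooth choice of
right inverses on the range for the linear maps of the same rank as `T₀`. -/
theorem ContinuousLinearMap.exists_contDiffOn_rightInverse_range {F F' : Type*}
    [NormedAddCommGroup F] [NormedSpace ℝ F] [FiniteDimensional ℝ F]
    [NormedAddCommGroup F'] [NormedSpace ℝ F'] [FiniteDimensional ℝ F'] (T₀ : F →L[ℝ] F') :
    ∃ U : Set (F →L[ℝ] F'), IsOpen U ∧ T₀ ∈ U ∧ ∃ G : (F →L[ℝ] F') → (F' →L[ℝ] F),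
      (∀ T ∈ U, ContDiffAt ℝ ∞ G T) ∧
      ∀ T ∈ U, Module.finrank ℝ (LinearMap.range (T : F →ₗ[ℝ] F'))
          = Module.finrank ℝ (LinearMap.range (T₀ : F →ₗ[ℝ] F')) →
        ∀ v ∈ LinearMap.range (T : F →ₗ[ℝ] F'), T (G T v) = v := by
  let W := LinearMap.range (T₀ : F →ₗ[ℝ] F')
  obtain ⟨p, hp⟩ := W.subtype.exists_leftInverse_of_injective W.ker_subtype
  obtain ⟨q, hq⟩ := (T₀ : F →ₗ[ℝ] F').rangeRestrict.exists_rightInverse_of_surjective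
    (LinearMap.range_rangeRestrict _)
  let P : F' →L[ℝ] W := p.toContinuousLinearMap
  let Q : W →L[ℝ] F := q.toContinuousLinearMap
  have : CompleteSpace W := FiniteDimensional.complete ℝ W
  -- P projects onto the range W of T₀ and Q is a section of T₀ over W. Thus PTQ is the identity at
  -- T₀, hence invertible nearby, and Q(PTQ)⁻¹P is the candidate inverse.
  let c : (F →L[ℝ] F') → (W →L[ℝ] W) := fun T => P.comp (T.comp Q)
  have hc : ContDiff ℝ ∞ c := contDiff_const.clm_comp (contDiff_id.clm_comp contDiff_const)
  have hc₀ : c T₀ = 1 := by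
    ext w
    have h1 : T₀ (q w) = (w : F') := congrArg Subtype.val (LinearMap.congr_fun hq w)
    have h2 : p (w : F') = w := LinearMap.congr_fun hp w
    change ((p (T₀ (q w)) : W) : F') = w
    rw [h1, h2]
  refine ⟨c ⁻¹' {A | IsUnit A}, (Units.isOpen (R := W →L[ℝ] W)).preimage hc.continuous, ?_,
    fun T => Q.comp ((Ring.inverse (c T)).comp P), ?_, ?_⟩
  · change IsUnit (c T₀)
    rw [hc₀]
    exact isUnit_one
  · rintro T ⟨A, hA⟩
    have hinv : ContDiffAt ℝ ∞ (fun T => Ring.inverse (c T)) T := by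
      refine ContDiffAt.comp T (g := Ring.inverse) ?_ hc.contDiffAt
      rw [← hA]
      exact contDiffAt_ringInverse ℝ (R := W →L[ℝ] W) A
    exact contDiffAt_const.clm_comp (hinv.clm_comp contDiffAt_const)
  · intro T hT hrank v hv
    have hmul : ∀ w, P (T (Q (Ring.inverse (c T) w))) = w := fun w =>
      DFunLike.congr_fun (Ring.mul_inverse_cancel (c T) hT) w
    let R := LinearMap.range (T : F →ₗ[ℝ] F')
    -- P maps range T onto W; equal rank makes it injective there, so T(G T v) and v agree because
    -- their images under P do.
    have hsurj : Function.Surjective (p.domRestrict R) := fun w =>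
      ⟨⟨T (Q (Ring.inverse (c T) w)), _, rfl⟩, hmul w⟩
    have hinj : Function.Injective (p.domRestrict R) :=
      (LinearMap.injective_iff_surjective_of_finrank_eq_finrank hrank).2 hsurj
    have := @hinj ⟨T (Q (Ring.inverse (c T) (P v))), _, rfl⟩ ⟨v, hv⟩ (hmul (P v))
    exact congrArg Subtype.val this

/-- Let `τ` be a smooth morphism of vector bundles over `M` of constant rank `r`. A smooth section
with values in the image of `τ` locally lifts to a smooth section. -/
theorem exists_contMDiffOn_lift_of_finrank_range_eq
    {E : Type*} [NormedAddCommGroup E] [NormedSpace ℝ E] {H : Type*} [TopologicalSpace H]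
    {I : ModelWithCorners ℝ E H} {M : Type*} [TopologicalSpace M] [ChartedSpace H M]
    {F : Type*} [NormedAddCommGroup F] [NormedSpace ℝ F] [FiniteDimensional ℝ F]
    {V : M → Type*} [TopologicalSpace (TotalSpace F V)] [∀ x, AddCommGroup (V x)]
    [∀ x, Module ℝ (V x)] [∀ x, TopologicalSpace (V x)] [FiberBundle F V] [VectorBundle ℝ F V]
    [ContMDiffVectorBundle ∞ F V I]
    {F' : Type*} [NormedAddCommGroup F'] [NormedSpace ℝ F'] [FiniteDimensional ℝ F']
    {V' : M → Type*} [TopologicalSpace (TotalSpace F' V')] [∀ x, AddCommGroup (V' x)]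
    [∀ x, Module ℝ (V' x)] [∀ x, TopologicalSpace (V' x)] [∀ x, IsTopologicalAddGroup (V' x)]
    [∀ x, ContinuousSMul ℝ (V' x)] [FiberBundle F' V'] [VectorBundle ℝ F' V']
    [ContMDiffVectorBundle ∞ F' V' I]
    {τ : ∀ x, V x →L[ℝ] V' x}
    (hτ : ContMDiff I (I.prod 𝓘(ℝ, F →L[ℝ] F')) ∞
      (fun x => TotalSpace.mk' (F →L[ℝ] F') (E := fun x => V x →L[ℝ] V' x) x (τ x)))
    {r : ℕ} (hr : ∀ x, Module.finrank ℝ (LinearMap.range (τ x : V x →ₗ[ℝ] V' x)) = r)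
    {a : ∀ x, V' x}
    (ha : ContMDiff I (I.prod 𝓘(ℝ, F')) ∞ (fun x => TotalSpace.mk' F' x (a x)))
    (haτ : ∀ x, a x ∈ LinearMap.range (τ x : V x →ₗ[ℝ] V' x)) (x : M) :
    ∃ U ∈ 𝓝 x, ∃ s : ∀ y : M, V y,
      ContMDiffOn I (I.prod 𝓘(ℝ, F)) ∞ (fun y => TotalSpace.mk' F y (s y)) U ∧
      ∀ y ∈ U, τ y (s y) = a y := by
  let e := trivializationAt F V x
  let e' := trivializationAt F' V' x
  let B := e.baseSet ∩ e'.baseSet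
  -- In trivializations τ becomes a smooth family of linear maps between fixed spaces, of the same
  -- constant rank.
  let T : M → (F →L[ℝ] F') := fun y => ContinuousLinearMap.inCoordinates F V F' V' x y x y (τ y)
  have hx : x ∈ B := ⟨FiberBundle.mem_baseSet_trivializationAt F V x,
    FiberBundle.mem_baseSet_trivializationAt F' V' x⟩
  have hB : IsOpen B := e.open_baseSet.inter e'.open_baseSet
  have hT : ContMDiffOn I 𝓘(ℝ, F →L[ℝ] F') ∞ T B := by
    have h := (Trivialization.contMDiffOn_section_baseSet_iff (IB := I) (n := ∞)
      (s := τ) (trivializationAt (F →L[ℝ] F') (fun y : M => V y →L[ℝ] V' y) x)).1 hτ.contMDiffOn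
    rw [hom_trivializationAt_baseSet] at h
    exact h
  have ha' : ContMDiffOn I 𝓘(ℝ, F') ∞ (fun y => (e' ⟨y, a y⟩).2) B :=
    ((e'.contMDiffOn_section_baseSet_iff).1 ha.contMDiffOn).mono Set.inter_subset_right
  have hTe : ∀ y (hy : y ∈ B), ∀ w, T y w = e'.continuousLinearEquivAt ℝ y hy.2
      (τ y ((e.continuousLinearEquivAt ℝ y hy.1).symm w)) := fun y hy w => by
    simp only [T]
    rw [ContinuousLinearMap.inCoordinates_eq hy.1 hy.2]
    rfl
  have hrange : ∀ y (hy : y ∈ B), LinearMap.range (T y : F →ₗ[ℝ] F')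
      = (LinearMap.range (τ y : V y →ₗ[ℝ] V' y)).map
        (e'.continuousLinearEquivAt ℝ y hy.2).toLinearEquiv.toLinearMap := by
    intro y hy
    ext w
    constructor
    · rintro ⟨z, rfl⟩
      exact ⟨_, ⟨_, rfl⟩, (hTe y hy z).symm⟩
    · rintro ⟨_, ⟨z, rfl⟩, rfl⟩
      refine ⟨e.continuousLinearEquivAt ℝ y hy.1 z, (hTe y hy _).trans ?_⟩
      rw [ContinuousLinearEquiv.symm_apply_apply]
      rfl
  have hrank : ∀ y ∈ B, Module.finrank ℝ (LinearMap.range (T y : F →ₗ[ℝ] F')) = r := by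
    intro y hy
    rw [hrange y hy, ← hr y]
    exact LinearEquiv.finrank_map_eq _ _
  obtain ⟨U, hU, hxU, G, hG, hGT⟩ := (T x).exists_contDiffOn_rightInverse_range
  refine ⟨B ∩ T ⁻¹' U, (hT.continuousOn.isOpen_inter_preimage hB hU).mem_nhds ⟨hx, hxU⟩,
    fun y => e.symm y (G (T y) (e' ⟨y, a y⟩).2), ?_, ?_⟩
  · intro y hy
    refine (e.contMDiffWithinAt_section _ hy.1.1).2 ?_
    have h1 : ContMDiffWithinAt I 𝓘(ℝ, F' →L[ℝ] F) ∞ (fun z => G (T z)) (B ∩ T ⁻¹' U) y :=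
      (hG _ hy.2).contMDiffAt.comp_contMDiffWithinAt y ((hT y hy.1).mono Set.inter_subset_left)
    refine (h1.clm_apply ((ha' y hy.1).mono Set.inter_subset_left)).congr (fun z hz => ?_) ?_
    · rw [e.apply_mk_symm hz.1.1]
    · rw [e.apply_mk_symm hy.1.1]
  · rintro y ⟨hy, hyU⟩
    apply (e'.continuousLinearEquivAt ℝ y hy.2).injective
    have h1 := hTe y hy (G (T y) (e' ⟨y, a y⟩).2)
    have h2 := hGT (T y) hyU ((hrank y hy).trans (hrank x hx).symm) (e' ⟨y, a y⟩).2 (by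
      rw [hrange y hy]
      exact ⟨a y, haτ y, rfl⟩)
    exact h1.symm.trans h2

/-! ### Global sections and the equivalence -/

namespace BigTangent

variable {m : ℕ} {M : Type*} [TopologicalSpace M]
  [ChartedSpace (EuclideanSpace ℝ (Fin m)) M] [IsManifold (𝓡 m) ∞ M] {τ : BigEndo m M}

/-- Provides the σ-compactness behind the partitions of unity used below. -/
theorem sigmaCompactSpace_of_chartedSpace (m : ℕ) (M : Type*) [TopologicalSpace M]
    [SecondCountableTopology M] [ChartedSpace (EuclideanSpace ℝ (Fin m)) M] :
    SigmaCompactSpace M := by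
  have := ChartedSpace.locallyCompactSpace (EuclideanSpace ℝ (Fin m)) M
  infer_instance

variable [T2Space M] [SecondCountableTopology M]

/-- Every vector is the value of a global smooth section. -/
theorem exists_section_apply_eq {x : M} (u : Big m M x) : ∃ s : BigSection m M, s x = u := by
  have := sigmaCompactSpace_of_chartedSpace m M
  -- The convex constraint is {u} in the fibre over x and the whole fibre elsewhere. Locally it is
  -- met by an extension of u near x, and by the zero section away from x.
  obtain ⟨s, hs⟩ := exists_contMDiffSection_forall_mem_convex_of_local (𝓡 m) (n := ⊤)
    (F_fiber := BigMod m) (Big m M) (fun y => {v | ∀ h : y = x, h ▸ v = u})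
    (fun y => by
      by_cases h : y = x
      · subst h
        simp
      · simpa [h] using convex_univ)
    (fun y => by
      by_cases h : y = x
      · subst h
        obtain ⟨U, hU, hs⟩ := FiberBundle.exists_contMDiffOn_extend (k := ∞) (𝓡 m) (BigMod m) u
        refine ⟨U, hU, _, hs, ?_⟩
        rintro z - rfl
        simp
      · refine ⟨{x}ᶜ, isOpen_compl_singleton.mem_nhds h, fun _ => 0,
          (0 : BigSection m M).contMDiff.contMDiffOn, ?_⟩
        intro z hz h'
        exact absurd h' hz)
  exact ⟨s, hs x rfl⟩

/-- The map `s ↦ τ s` from sections of the big tangent bundle to sections of `im τ` is onto. -/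
theorem applyImage_surjective (hτ : IsTwoNilpotent τ) : Function.Surjective (applyImage τ) := by
  intro a
  obtain ⟨r, hr⟩ := hτ.const_rank
  have := sigmaCompactSpace_of_chartedSpace m M
  -- The solutions v of τv = a in a fibre form a convex set, so the local lifts glue.
  obtain ⟨s, hs⟩ := exists_contMDiffSection_forall_mem_convex_of_local (𝓡 m) (n := ⊤)
    (F_fiber := BigMod m) (Big m M) (fun y => {v | τ y v = a.1 y})
    (fun y => (convex_singleton (a.1 y)).linear_preimage (τ y : Big m M y →ₗ[ℝ] Big m M y))
    (exists_contMDiffOn_lift_of_finrank_range_eq τ.contMDiff hr a.1.contMDiff a.2)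
  exact ⟨s, Subtype.ext (ContMDiffSection.ext hs)⟩

/-- Solving N_τ(s, t) = 0 for [τs, τt] exhibits it as τ of a section, and every section of E is some
τs. -/
theorem isWeaklyIntegrable_of_isIntegrable (hτ : IsTwoNilpotent τ) (h : IsIntegrable τ) :
    IsWeaklyIntegrable τ := by
  intro a ha b hb x
  obtain ⟨s, hs⟩ := applyImage_surjective hτ ⟨a, ha⟩
  obtain ⟨t, ht⟩ := applyImage_surjective hτ ⟨b, hb⟩
  obtain rfl : apply τ s = a := congrArg Subtype.val hs
  obtain rfl : apply τ t = b := congrArg Subtype.val ht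
  refine ⟨courant s (apply τ t) x + courant (apply τ s) t x - apply τ (courant s t) x, ?_⟩
  have hN : courant (apply τ s) (apply τ t) x - τ x (courant s (apply τ t) x)
      - τ x (courant (apply τ s) t x) + τ x (apply τ (courant s t) x) = 0 :=
    DFunLike.congr_fun (h s t) x
  change τ x _ = _
  rw [(τ x).map_sub, (τ x).map_add, eq_comm, ← sub_eq_zero, ← hN]
  abel

/-- Only closedness draws on the vanishing torsion; smoothness comes from lifting b to t, which
gives ω(a, b) = g(a, t). -/
theorem isSymplecticForm_omega (hτ : IsTwoNilpotent τ) (h : IsIntegrable τ)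
    (hw : IsWeaklyIntegrable τ) : IsSymplecticForm hw (omega hτ) where
  smooth a b := by
    obtain ⟨t, rfl⟩ := applyImage_surjective hτ b
    rw [evalForm_omega_applyImage]
    exact contMDiff_neutral a.1 t
  alt := omega_isAlt hτ
  nondegenerate := omega_nondegenerate hτ
  closed a b c x := by
    obtain ⟨X, rfl⟩ := applyImage_surjective hτ a
    obtain ⟨Y, rfl⟩ := applyImage_surjective hτ b
    obtain ⟨Z, rfl⟩ := applyImage_surjective hτ c
    rw [algDiff_omega, h Y Z]
    simp [neutral]

theorem isIntegrable_of_algDiff_omega_eq_zero (hτ : IsTwoNilpotent τ) (hw : IsWeaklyIntegrable τ)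
    (h : ∀ (a b c : imageSections τ) (x : M), algDiff hw (omega hτ) a b c x = 0) :
    IsIntegrable τ := by
  intro s t
  refine ContMDiffSection.ext fun x => eq_zero_of_forall_neutral fun u => ?_
  obtain ⟨X, rfl⟩ := exists_section_apply_eq u
  rw [neutral_comm, ← neg_eq_zero, ← algDiff_omega hτ hw X s t x]
  exact h _ _ _ x

end BigTangent

open BigTangent in
theorem proposition4p1 {m : ℕ} {M : Type*} [TopologicalSpace M] [T2Space M]
    [SecondCountableTopology M] [ChartedSpace (EuclideanSpace ℝ (Fin m)) M]
    [IsManifold (𝓡 m) ∞ M] (τ : BigEndo m M) (hτ : IsTwoNilpotent τ) :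
    (IsIntegrable τ ↔ ∃ h : IsWeaklyIntegrable τ, IsSymplecticForm h (omega hτ)) ∧
      ∀ (h : IsWeaklyIntegrable τ) (X Y Z : BigSection m M) (x : M),
        algDiff h (omega hτ) (applyImage τ X) (applyImage τ Y) (applyImage τ Z) x
          = - neutral (X x) (torsion τ Y Z x) :=
  ⟨⟨fun h => ⟨isWeaklyIntegrable_of_isIntegrable hτ h,
      isSymplecticForm_omega hτ h (isWeaklyIntegrable_of_isIntegrable hτ h)⟩,
    fun ⟨hw, h⟩ => isIntegrable_of_algDiff_omega_eq_zero hτ hw h.closed⟩,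
    algDiff_omega hτ⟩
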